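/- Let $m>2$ be an even integer. An integral $m$-ic form of rank $n\ge 0$ is a homogeneous polynomial $Q$ of degree $m$ in $n$ variables with integer coefficients (the zero polynomial being allowed). It is positive definite if $Q(x)>0$ for all $x\in\mathbb{R}^n$, $x\neq 0$; it represents $a\in\mathbb{Z}$ if $Q(x)=a$ for some $x\in\mathbb{Z}^n$; a positive definite form is universal if it represents every positive integer. Let $g(m)$ be the least integer $k$ such that every positive integer is a sum of at most $k$ $m$th powers of positive integers. Let $\mathcal{A}\subset\mathbb{Z}_{>0}$ be a finite (possibly empty) set. Then the following conditions are equivalent: (1) There exists a positive definite integral $m$-ic form $Q$ that represents exactly the integers in $\mathbb{Z}_{\geq 0}\setminus\mathcal{A}$. (2) For all $a,b\in\mathbb{Z}$, if $ab^m\in\mathcal{A}$, then $a\in\mathcal{A}$. Moreover, if these conditions hold, then $Q$ in (1) can be chosen of rank $<(B+1)(g(m)+1)$, where $B$ is the largest element of $\mathcal{A}$ (and $B=0$ if $\mathcal{A}=\emptyset$). In particular, there is no finite criterion set for universality of $m$-ic forms over $\mathbb{Z}$: there is no finite set $S\subset\mathbb{Z}$ such that a positive definite integral $m$-ic form (of any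 rank) is universal if and only if it represents all elements of $S$. -/

import Mathlib

/-- `Q` is an integral positive definite `m`-ic form in `n` variables: a homogeneous polynomial of
degree `m` with integer coefficients that is positive at all nonzero real points. The rank of such
a form is its number of variables `n`. -/
structure IsPosDefForm (m : ℕ) {n : ℕ} (Q : MvPolynomial (Fin n) ℤ) : Prop where
  homogeneous : Q.IsHomogeneous m
  pos : ∀ x : Fin n → ℝ, x ≠ 0 → 0 < MvPolynomial.aeval x Q

/-- The integer `a` is a value of `Q` at some integer point. -/
def Represents {n : ℕ} (Q : MvPolynomial (Fin n) ℤ) (a : ℤ) : Prop :=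
  ∃ x : Fin n → ℤ, MvPolynomial.eval x Q = a

/-- `Q` represents exactly the nonnegative integers outside `A`. -/
def RepresentsExactlyCompl {n : ℕ} (Q : MvPolynomial (Fin n) ℤ) (A : Finset ℤ) : Prop :=
  ∀ a : ℤ, Represents Q a ↔ 0 ≤ a ∧ a ∉ A

/-- A (positive definite) form is universal if it represents all positive integers. -/
def IsUniversal {n : ℕ} (Q : MvPolynomial (Fin n) ℤ) : Prop :=
  ∀ a : ℤ, 0 < a → Represents Q a

/-- `S` is a criterion set for universality of `m`-ic forms over `ℤ`: a positive definite `m`-ic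
form, in any number of variables, is universal if and only if it represents all elements
of `S`. -/
def IsCriterionSet (m : ℕ) (S : Set ℤ) : Prop :=
  ∀ (n : ℕ) (Q : MvPolynomial (Fin n) ℤ), IsPosDefForm m Q →
    (IsUniversal Q ↔ ∀ a ∈ S, Represents Q a)

/-- Waring's constant `g(m)`, for `m ≥ 1`: the least `k` such that every positive integer is a sum
of at most `k` `m`-th powers of positive integers, that is, of exactly `k` `m`-th powers of
nonnegative integers. -/
noncomputable def waringG (m : ℕ) : ℕ :=
  sInf {k : ℕ | ∀ N : ℕ, 0 < N → ∃ x : Fin k → ℕ, ∑ i, x i ^ m = N}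

/-- The largest element of a finite set of positive integers, with the value `0` for the
empty set. -/
def largestElement (A : Finset ℤ) : ℕ := A.sup Int.toNat

theorem largestElement_isGreatest (A : Finset ℤ) (hA : ∀ a ∈ A, 0 < a) (hne : A.Nonempty) :
    IsGreatest (A : Set ℤ) (largestElement A : ℤ) := by
  constructor
  · obtain ⟨a, ha, h⟩ := Finset.exists_mem_eq_sup A hne Int.toNat
    have h0 := hA a ha
    have h1 : (largestElement A : ℤ) = a := by
      rw [largestElement, h]
      omega
    rw [h1]
    exact ha
  · intro a ha
    have h := Finset.le_sup (f := Int.toNat) (Finset.mem_coe.mp ha)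
    rw [largestElement]
    omega

/-! Necessity of (2) is homogeneity: Q(bx) = b^m Q(x). For sufficiency, use `separatedForm`. It has
one diagonal coefficient eᵢ ≡ i mod B + 1 for each i = 1, …, B, namely i if i ∉ A and B + 1 + i
otherwise. Everything else is B + 1 times a nonnegative form: mixed terms xᵢ²xⱼ^(m-2) and a sum of
g(m) m-th powers. A positive value at most B kills the multiples of B + 1, hence all but one xᵢ, so
it equals eᵢb^m with eᵢ ∉ A, and (2) keeps it outside A. Conversely, the m-th powers move 0 or eᵢ by
any nonnegative multiple of B + 1, which yields every nonnegative integer outside A. Omitting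
exactly one large prime then defeats any finite criterion set.

The construction needs g(m) to be finite, so most of the work is the Hilbert–Waring theorem
`waringHolds`. Its engine is `hilbert_identity`: a Gaussian vector paired with x has moments
depending only on |x|², and a cubature formula with integral nodes replaces the Gaussian integral by
a finite sum. Waring for k follows from all l < k. Four squares and Hilbert's identity lift exponent
l to 2l, and Taylor coefficients of the identity then let multiples of sums of 2k-th powers be
prescribed digit by digit in base T, modulo T^k. The remaining multiple of T^k is a bounded number
of k-th powers. -/

/-! ### Gaussian moments and nonnegative polynomials -/

open MeasureTheory in
theorem integrable_pow_mul_gaussian (n : ℕ) :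
    Integrable fun x : ℝ => x ^ n * Real.exp (-(1 / 2) * x ^ 2) := by
  have h := integrable_rpow_mul_exp_neg_mul_sq (b := 1 / 2) (by norm_num) (s := n)
    (by linarith [(Nat.cast_nonneg n : (0 : ℝ) ≤ n)])
  simpa [Real.rpow_natCast] using h

/-- The moments of the standard Gaussian distribution. -/
def gaussMoment : ℕ → ℕ
  | 0 => 1
  | 1 => 0
  | n + 2 => (n + 1) * gaussMoment n

open MeasureTheory in
theorem integral_pow_mul_gaussian_add_two (n : ℕ) :
    ∫ x : ℝ, x ^ (n + 2) * Real.exp (-(1 / 2) * x ^ 2) =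
      (n + 1) * ∫ x : ℝ, x ^ n * Real.exp (-(1 / 2) * x ^ 2) := by
  have hd : ∀ x : ℝ, HasDerivAt (fun x : ℝ => x ^ (n + 1) * Real.exp (-(1 / 2) * x ^ 2))
      ((n + 1) * (x ^ n * Real.exp (-(1 / 2) * x ^ 2)) -
        x ^ (n + 2) * Real.exp (-(1 / 2) * x ^ 2)) x := by
    intro x
    have h1 := (hasDerivAt_pow (n + 1) x).mul (((hasDerivAt_pow 2 x).const_mul (-(1 / 2))).exp)
    convert! h1 using 1
    push_cast
    ring_nf
  have h := integral_eq_zero_of_hasDerivAt_of_integrable hd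
    (((integrable_pow_mul_gaussian n).const_mul _).sub (integrable_pow_mul_gaussian (n + 2)))
    (integrable_pow_mul_gaussian (n + 1))
  rw [integral_sub ((integrable_pow_mul_gaussian n).const_mul _)
    (integrable_pow_mul_gaussian (n + 2)), integral_const_mul] at h
  linarith

open MeasureTheory in
theorem integral_id_mul_gaussian : ∫ x : ℝ, x ^ 1 * Real.exp (-(1 / 2) * x ^ 2) = 0 := by
  have hd : ∀ x : ℝ, HasDerivAt (fun x : ℝ => x ^ 0 * Real.exp (-(1 / 2) * x ^ 2))
      ((-1) * (x ^ 1 * Real.exp (-(1 / 2) * x ^ 2))) x := by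
    intro x
    have h1 := (hasDerivAt_pow 0 x).mul (((hasDerivAt_pow 2 x).const_mul (-(1 / 2))).exp)
    convert! h1 using 1
    push_cast
    ring
  have h := integral_eq_zero_of_hasDerivAt_of_integrable hd
    ((integrable_pow_mul_gaussian 1).const_mul _) (integrable_pow_mul_gaussian 0)
  rw [integral_const_mul] at h
  linarith

theorem integral_pow_mul_gaussian (n : ℕ) :
    ∫ x : ℝ, x ^ n * Real.exp (-(1 / 2) * x ^ 2) =
      gaussMoment n * ∫ x : ℝ, Real.exp (-(1 / 2) * x ^ 2) := by
  induction n using gaussMoment.induct with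
  | case1 => simp [gaussMoment]
  | case2 => rw [integral_id_mul_gaussian]; simp [gaussMoment]
  | case3 n ih =>
    rw [integral_pow_mul_gaussian_add_two, ih, gaussMoment]
    push_cast
    ring

open Polynomial in
theorem coeff_eq_zero_of_forall_eval {N : ℕ} (c₀ : ℝ) (c : Fin N → ℝ)
    (h : ∀ x : ℝ, c₀ + ∑ i, c i * x ^ (i.val + 1) = 0) : c = 0 := by
  have hp : C c₀ + ∑ i : Fin N, C (c i) * X ^ (i.val + 1) = 0 :=
    Polynomial.funext fun x => by simpa [eval_finsetSum] using h x
  funext j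
  have h1 := congrArg (fun p => p.coeff (j.val + 1)) hp
  simpa [coeff_C, coeff_X_pow, Fin.val_inj] using h1

open MeasureTheory in
/-- A nonnegative real polynomial with vanishing Gaussian expectation is zero. -/
theorem coeff_eq_zero_of_nonneg_of_gaussian_eq_zero {N : ℕ} (c₀ : ℝ) (c : Fin N → ℝ)
    (hp : ∀ x : ℝ, 0 ≤ c₀ + ∑ i, c i * x ^ (i.val + 1))
    (h0 : c₀ + ∑ i, c i * gaussMoment (i.val + 1) = 0) : c = 0 := by
  have h : (fun x : ℝ => (c₀ + ∑ i, c i * x ^ (i.val + 1)) * Real.exp (-(1 / 2) * x ^ 2)) =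
      fun x => c₀ * (x ^ 0 * Real.exp (-(1 / 2) * x ^ 2)) +
        ∑ i, c i * (x ^ (i.val + 1) * Real.exp (-(1 / 2) * x ^ 2)) := by
    funext x
    rw [add_mul, Finset.sum_mul]
    simp_rw [mul_assoc, pow_zero, one_mul]
  have hi₀ := (integrable_pow_mul_gaussian 0).const_mul c₀
  have hi₁ : ∀ i ∈ (Finset.univ : Finset (Fin N)),
      Integrable fun x : ℝ => c i * (x ^ (i.val + 1) * Real.exp (-(1 / 2) * x ^ 2)) :=
    fun i _ => (integrable_pow_mul_gaussian _).const_mul _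
  have hi : Integrable fun x : ℝ =>
      (c₀ + ∑ i, c i * x ^ (i.val + 1)) * Real.exp (-(1 / 2) * x ^ 2) := by
    rw [h]
    exact hi₀.add (integrable_finsetSum _ hi₁)
  have he : ∫ x : ℝ, (c₀ + ∑ i, c i * x ^ (i.val + 1)) * Real.exp (-(1 / 2) * x ^ 2) = 0 := by
    rw [h, integral_add hi₀ (integrable_finsetSum _ hi₁), integral_finsetSum _ hi₁]
    simp_rw [integral_const_mul, integral_pow_mul_gaussian, ← mul_assoc]
    rw [← Finset.sum_mul, ← add_mul]
    simp [gaussMoment, h0]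
  rw [integral_eq_zero_iff_of_nonneg
    (fun x => mul_nonneg (hp x) (Real.exp_pos _).le) hi] at he
  have hc : Continuous fun x : ℝ =>
      (c₀ + ∑ i, c i * x ^ (i.val + 1)) * Real.exp (-(1 / 2) * x ^ 2) := by fun_prop
  have h1 := (hc.ae_eq_iff_eq volume continuous_const).1 he
  refine coeff_eq_zero_of_forall_eval c₀ c fun x => ?_
  have h2 : (c₀ + ∑ i, c i * x ^ (i.val + 1)) * Real.exp (-(1 / 2) * x ^ 2) = 0 := congrFun h1 x
  exact (mul_eq_zero.1 h2).resolve_right (Real.exp_pos _).ne'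

/-! ### Gaussian quadrature with rational data -/

/-- The point with coordinates `t, t ^ 2, …, t ^ N`. -/
def momentCurve (N : ℕ) (t : ℝ) : Fin N → ℝ := fun i => t ^ (i.val + 1)

theorem dual_apply_eq_sum {N : ℕ} (f : (Fin N → ℝ) →ₗ[ℝ] ℝ) (x : Fin N → ℝ) :
    f x = ∑ i, f (Pi.single i 1) * x i := by
  rw [LinearMap.pi_apply_eq_sum_univ f x]
  refine Finset.sum_congr rfl fun i _ => ?_
  rw [smul_eq_mul, mul_comm]
  congr 2
  funext j
  simp [Pi.single_apply, eq_comm]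

theorem dual_eq_zero_of_single {N : ℕ} (f : (Fin N → ℝ) →ₗ[ℝ] ℝ)
    (h : (fun i => f (Pi.single i 1)) = 0) : f = 0 := by
  ext i
  simpa using congrFun h i

theorem forall_real_of_forall_rat {g : ℝ → ℝ} (hg : Continuous g) (h : ∀ q : ℚ, 0 ≤ g q) (t : ℝ) :
    0 ≤ g t :=
  Rat.denseRange_cast.induction_on (p := fun t : ℝ => 0 ≤ g t) t
    (isClosed_Ici.preimage hg) h

/-- A linear form vanishing on the curve is a polynomial with infinitely many zeros, so the curve
lies in no hyperplane through its point 0. The interior permits separation even of a boundary point.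
-/
theorem interior_convexHull_momentCurve_nonempty (N : ℕ) :
    (interior (convexHull ℝ (Set.range fun q : ℚ => momentCurve N q))).Nonempty := by
  rw [interior_convexHull_nonempty_iff_affineSpan_eq_top,
    AffineSubspace.affineSpan_eq_top_iff_vectorSpan_eq_top_of_nonempty _ _ _ (Set.range_nonempty _)]
  by_contra hne
  obtain ⟨f, hf, hle⟩ := Submodule.exists_le_ker_of_lt_top _ (lt_top_iff_ne_top.2 hne)
  have hq : ∀ q : ℚ, f (momentCurve N q) = 0 := fun q => by
    have h := hle (vsub_mem_vectorSpan ℝ (Set.mem_range_self q) (Set.mem_range_self 0))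
    rw [LinearMap.mem_ker, vsub_eq_sub, map_sub] at h
    have h0 : momentCurve N ((0 : ℚ) : ℝ) = 0 := by funext i; simp [momentCurve]
    rwa [h0, map_zero, sub_zero] at h
  have hc : Continuous fun t : ℝ => ∑ i, f (Pi.single i 1) * momentCurve N t i := by
    unfold momentCurve; fun_prop
  have h1 := forall_real_of_forall_rat hc fun q => by rw [← dual_apply_eq_sum, hq]
  have h2 : ∀ t : ℝ, 0 ≤ -∑ i, f (Pi.single i 1) * momentCurve N t i :=
    forall_real_of_forall_rat hc.neg fun q => by
      rw [← dual_apply_eq_sum, hq, neg_zero]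
  refine hf (dual_eq_zero_of_single f (coeff_eq_zero_of_forall_eval 0 _ fun t => ?_))
  have h3 := h1 t
  have h4 := h2 t
  unfold momentCurve at h3 h4
  linarith

/-- A functional separating the moment vector from the hull would give a nonzero polynomial that is
nonnegative on ℝ but has Gaussian expectation zero. -/
theorem gaussMoment_mem_convexHull (N : ℕ) :
    (fun i : Fin N => (gaussMoment (i.val + 1) : ℝ)) ∈
      convexHull ℝ (Set.range fun q : ℚ => momentCurve N q) := by
  by_contra hmem
  obtain ⟨f, u, hf, hle, hu⟩ := geometric_hahn_banach_of_nonempty_interior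
    (convex_convexHull ℝ (Set.range fun q : ℚ => momentCurve N q))
    (convex_singleton (fun i : Fin N => (gaussMoment (i.val + 1) : ℝ)))
    (Set.disjoint_singleton_right.2 fun h => hmem (interior_subset h))
    (interior_convexHull_momentCurve_nonempty N) (Set.singleton_nonempty _)
  have hf' : ∀ x, f x = ∑ i, f (Pi.single i 1) * x i := fun x => dual_apply_eq_sum f.toLinearMap x
  have hu' := hu _ rfl
  have hc : Continuous fun t : ℝ =>
      f (fun i : Fin N => (gaussMoment (i.val + 1) : ℝ)) +
        ∑ i, -f (Pi.single i 1) * t ^ (i.val + 1) := by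
    fun_prop
  have hz := coeff_eq_zero_of_nonneg_of_gaussian_eq_zero
    (f (fun i : Fin N => (gaussMoment (i.val + 1) : ℝ))) (fun i => -f (Pi.single i 1))
    (forall_real_of_forall_rat hc fun q => by
      have h := hle _ (subset_convexHull ℝ _ (Set.mem_range_self q))
      rw [hf'] at h
      simp only [neg_mul, Finset.sum_neg_distrib]
      unfold momentCurve at h
      linarith)
    (by rw [hf']; simp)
  refine hf (ContinuousLinearMap.coe_injective (dual_eq_zero_of_single f.toLinearMap ?_))
  funext i
  simpa using congrFun hz i

/-- A quadrature formula with rational nodes and positive rational weights for the Gaussian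
distribution. -/
theorem exists_rat_quadrature (N : ℕ) :
    ∃ (ι : Type) (_ : Fintype ι) (w q : ι → ℚ), (∀ j, 0 < w j) ∧
      ∀ i ≤ N, ∑ j, w j * q j ^ i = gaussMoment i := by
  obtain ⟨ι, hι, z, w, hz, haff, hw, hsum, heq⟩ :=
    eq_pos_convex_span_of_mem_convexHull (gaussMoment_mem_convexHull N)
  choose q hq using fun j => hz (Set.mem_range_self j)
  have hmom : ∀ i ≤ N, ∑ j, w j * (q j : ℝ) ^ i = gaussMoment i := by
    rintro (_ | i) hi
    · simpa [gaussMoment] using hsum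
    · have h := congrFun heq ⟨i, hi⟩
      simpa [← hq, momentCurve] using h
  -- A ℚ-linear retraction ℝ → ℚ sends the weights to rational solutions of the same moment
  -- equations; affine independence of the Carathéodory nodes makes the solution unique, so the
  -- weights were already rational.
  obtain ⟨π, hπ⟩ := (Algebra.linearMap ℚ ℝ).exists_leftInverse_of_injective
    (LinearMap.ker_eq_bot.2 (algebraMap ℚ ℝ).injective)
  have hπ' : ∀ r : ℚ, π (r : ℝ) = r := fun r => by simpa using LinearMap.congr_fun hπ r
  have hmomπ : ∀ i ≤ N, ∑ j, π (w j) * q j ^ i = gaussMoment i := fun i hi => by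
    have h := congrArg π (hmom i hi)
    rw [map_sum] at h
    calc ∑ j, π (w j) * q j ^ i = ∑ j, π (w j * (q j : ℝ) ^ i) := by
          refine Finset.sum_congr rfl fun j _ => ?_
          have hs : w j * (q j : ℝ) ^ i = (q j ^ i : ℚ) • w j := by
            rw [Rat.smul_def]; push_cast; ring
          rw [hs, map_smul, smul_eq_mul, mul_comm]
      _ = π ((gaussMoment i : ℚ) : ℝ) := by rw [h]; norm_cast
      _ = gaussMoment i := hπ' _
  have hmomπ' : ∀ i ≤ N, ∑ j, (π (w j) : ℝ) * (q j : ℝ) ^ i = gaussMoment i :=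
    fun i hi => by exact_mod_cast congrArg (fun r : ℚ => (r : ℝ)) (hmomπ i hi)
  have hdiff : ∀ i ≤ N, ∑ j, (w j - π (w j)) * (q j : ℝ) ^ i = 0 := fun i hi => by
    simp_rw [sub_mul]
    rw [Finset.sum_sub_distrib, hmom i hi, hmomπ' i hi, sub_self]
  have hrat : ∀ j, w j - π (w j) = 0 := fun j => by
    refine haff.eq_zero_of_sum_eq_zero (s := Finset.univ) (w := fun j => w j - π (w j)) ?_ ?_ j
      (Finset.mem_univ j)
    · simpa using hdiff 0 (Nat.zero_le N)
    · funext i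
      simpa [← hq, momentCurve] using hdiff (i.val + 1) i.isLt
  refine ⟨ι, hι, fun j => π (w j), q, fun j => ?_, hmomπ⟩
  have h := hw j
  rw [sub_eq_zero.1 (hrat j)] at h
  exact_mod_cast h

theorem exists_common_denominator {ι : Type*} [Fintype ι] (q : ι → ℚ) :
    ∃ D : ℕ, 0 < D ∧ ∃ b : ι → ℤ, ∀ j, (b j : ℚ) = D * q j := by
  classical
  refine ⟨∏ j, (q j).den, Finset.prod_pos fun j _ => (q j).den_pos,
    fun j => (∏ i ∈ Finset.univ.erase j, (q i).den : ℕ) * (q j).num, fun j => ?_⟩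
  rw [← Finset.mul_prod_erase Finset.univ (fun i => (q i).den) (Finset.mem_univ j)]
  push_cast
  nth_rewrite 3 [← Rat.num_div_den (q j)]
  field_simp

/-- A quadrature formula with integral nodes and weights for a dilated and rescaled Gaussian
distribution. -/
theorem exists_int_quadrature (N : ℕ) :
    ∃ (ι : Type) (_ : Fintype ι) (a : ι → ℕ) (b : ι → ℤ) (M d : ℕ), 0 < M ∧ 0 < d ∧
      ∀ i ≤ N, ∑ j, (a j : ℤ) * b j ^ i = M * d ^ i * gaussMoment i := by
  obtain ⟨ι, hι, w, q, hw, hq⟩ := exists_rat_quadrature N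
  obtain ⟨M, hM, a, ha⟩ := exists_common_denominator w
  obtain ⟨d, hd, b, hb⟩ := exists_common_denominator q
  refine ⟨ι, hι, fun j => (a j).toNat, b, M, d, hM, hd, fun i hi => ?_⟩
  have hpos : ∀ j, 0 ≤ a j := fun j => by
    have : (0 : ℚ) ≤ a j := by rw [ha]; have := hw j; positivity
    exact_mod_cast this
  have h : (∑ j, (a j : ℚ) * (b j : ℚ) ^ i) = M * d ^ i * gaussMoment i := by
    rw [← hq i hi, Finset.mul_sum]
    refine Finset.sum_congr rfl fun j _ => ?_
    rw [ha, hb]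
    ring
  simp_rw [Int.toNat_of_nonneg (hpos _)]
  exact_mod_cast h

/-! ### Cubature in n dimensions and Hilbert's identity -/

/-- The moments of the centred Gaussian distribution of variance `A`. -/
def gaussMomentVar (A : ℤ) : ℕ → ℤ
  | 0 => 1
  | 1 => 0
  | n + 2 => (n + 1) * A * gaussMomentVar A n

theorem gaussMomentVar_sq (y : ℤ) (n : ℕ) :
    gaussMomentVar (y ^ 2) n = y ^ n * gaussMoment n := by
  induction n using gaussMoment.induct with
  | case1 => simp [gaussMoment, gaussMomentVar]
  | case2 => simp [gaussMoment, gaussMomentVar]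
  | case3 n ih =>
    rw [gaussMomentVar, gaussMoment, ih]
    simp only [Nat.succ_eq_add_one]
    push_cast
    ring

theorem gaussMomentVar_two_mul (A : ℤ) (k : ℕ) :
    gaussMomentVar A (2 * k) = gaussMoment (2 * k) * A ^ k := by
  induction k with
  | zero => simp [gaussMoment, gaussMomentVar]
  | succ k ih =>
    rw [Nat.mul_succ, gaussMomentVar, gaussMoment, ih]
    push_cast
    ring

theorem gaussMoment_two_mul_pos (k : ℕ) : 0 < gaussMoment (2 * k) := by
  induction k with
  | zero => simp [gaussMoment]
  | succ k ih =>
    rw [Nat.mul_succ, gaussMoment]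
    positivity

theorem gaussMomentVar_zero (n : ℕ) : gaussMomentVar 0 n = 0 ^ n := by
  match n with
  | 0 => simp [gaussMomentVar]
  | 1 => simp [gaussMomentVar]
  | n + 2 => simp [gaussMomentVar]

open Finset in
theorem sum_antidiagonal_gaussMomentVar_succ (A : ℤ) (f : ℕ → ℤ) (n : ℕ) :
    ∑ p ∈ antidiagonal (n + 1),
        ((n + 1).choose p.1 : ℤ) * (gaussMomentVar A (p.1 + 1) * f p.2) =
      (n + 1) * A * ∑ p ∈ antidiagonal n, (n.choose p.1 : ℤ) * (gaussMomentVar A p.1 * f p.2) := by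
  rw [Nat.sum_antidiagonal_succ, mul_sum]
  simp only [gaussMomentVar, zero_mul, mul_zero, zero_add]
  refine sum_congr rfl fun p _ => ?_
  have h : ((n + 1).choose (p.1 + 1) : ℤ) * (p.1 + 1) = (n + 1) * n.choose p.1 := by
    exact_mod_cast (Nat.add_one_mul_choose_eq n p.1).symm
  linear_combination (A * gaussMomentVar A p.1 * f p.2) * h

open Finset in
theorem sum_antidiagonal_gaussMomentVar_succ' (B : ℤ) (f : ℕ → ℤ) (n : ℕ) :
    ∑ p ∈ antidiagonal (n + 1),
        ((n + 1).choose p.1 : ℤ) * (f p.1 * gaussMomentVar B (p.2 + 1)) =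
      (n + 1) * B * ∑ p ∈ antidiagonal n, (n.choose p.1 : ℤ) * (f p.1 * gaussMomentVar B p.2) := by
  rw [Nat.sum_antidiagonal_succ', mul_sum]
  simp only [gaussMomentVar, mul_zero, zero_add]
  refine sum_congr rfl fun p hp => ?_
  have hp' := mem_antidiagonal.1 hp
  have h : ((n + 1).choose p.1 : ℤ) * (p.2 + 1) = (n + 1) * n.choose p.1 := by
    have h := Nat.choose_mul_succ_eq n p.1
    rw [show n + 1 - p.1 = p.2 + 1 by omega] at h
    rw [mul_comm ((n : ℤ) + 1)]
    exact_mod_cast h.symm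
  linear_combination (B * f p.1 * gaussMomentVar B p.2) * h

open Finset in
/-- The sum of two independent Gaussian variables is Gaussian. -/
theorem gaussMomentVar_add (A B : ℤ) (n : ℕ) :
    ∑ p ∈ antidiagonal n,
        (n.choose p.1 : ℤ) * (gaussMomentVar A p.1 * gaussMomentVar B p.2) =
      gaussMomentVar (A + B) n := by
  induction n using gaussMoment.induct with
  | case1 => simp [gaussMomentVar]
  | case2 => simp [gaussMomentVar, Nat.sum_antidiagonal_succ]
  | case3 n ih =>
    have h := sum_antidiagonal_choose_succ_mul
      (fun i j => gaussMomentVar A i * gaussMomentVar B j) (n + 1)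
    have hsymm : ∑ p ∈ antidiagonal (n + 1), ((n + 1).choose p.2 : ℤ) *
        (gaussMomentVar A (p.1 + 1) * gaussMomentVar B p.2) =
        ∑ p ∈ antidiagonal (n + 1), ((n + 1).choose p.1 : ℤ) *
          (gaussMomentVar A (p.1 + 1) * gaussMomentVar B p.2) :=
      sum_congr rfl fun p hp => by
        rw [Nat.choose_symm_of_eq_add (mem_antidiagonal.1 hp).symm]
    rw [hsymm, sum_antidiagonal_gaussMomentVar_succ,
      sum_antidiagonal_gaussMomentVar_succ' B (gaussMomentVar A), ih] at h
    rw [gaussMomentVar, h]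
    ring

/-- A cubature formula with integral nodes and weights for a dilated and rescaled Gaussian
distribution in `n` dimensions. -/
theorem exists_int_cubature (N n : ℕ) :
    ∃ (ι : Type) (_ : Fintype ι) (a : ι → ℕ) (b : ι → Fin n → ℤ) (M d : ℕ), 0 < M ∧ 0 < d ∧
      ∀ i ≤ N, ∀ x : Fin n → ℤ, ∑ j, (a j : ℤ) * (∑ t, b j t * x t) ^ i =
        M * gaussMomentVar (d ^ 2 * ∑ t, x t ^ 2) i := by
  obtain ⟨κ, hκ, α, β, M, d, hM, hd, hq⟩ := exists_int_quadrature N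
  -- The dilation d must be common to all coordinates, so it is fixed before the induction; the
  -- cubature is a product of copies of one quadrature.
  suffices h : ∃ (ι : Type) (_ : Fintype ι) (a : ι → ℕ) (b : ι → Fin n → ℤ) (M : ℕ), 0 < M ∧
      ∀ i ≤ N, ∀ x : Fin n → ℤ, ∑ j, (a j : ℤ) * (∑ t, b j t * x t) ^ i =
        M * gaussMomentVar (d ^ 2 * ∑ t, x t ^ 2) i by
    obtain ⟨ι, hι, a, b, M, hM, h⟩ := h
    exact ⟨ι, hι, a, b, M, d, hM, hd, h⟩
  induction n with
  | zero => exact ⟨Unit, inferInstance, 1, 0, 1, one_pos, by simp [gaussMomentVar_zero]⟩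
  | succ n ih =>
    obtain ⟨ι, hι, a, b, M', hM', h⟩ := ih
    refine ⟨κ × ι, inferInstance, fun p => α p.1 * a p.2, fun p => Fin.cons (β p.1) (b p.2),
      M * M', Nat.mul_pos hM hM', fun i hi x => ?_⟩
    simp only [Fin.sum_univ_succ, Fin.cons_zero, Fin.cons_succ, Fintype.sum_prod_type]
    rw [mul_add, ← gaussMomentVar_add, Finset.mul_sum]
    have hpow : ∀ u v : ℤ, (u + v) ^ i =
        ∑ p ∈ Finset.HasAntidiagonal.antidiagonal i, (i.choose p.1 : ℤ) * (u ^ p.1 * v ^ p.2) := fun u v => by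
      rw [(Commute.all u v).add_pow']
      simp
    simp_rw [hpow, Finset.mul_sum]
    simp_rw [Finset.sum_comm (t := Finset.HasAntidiagonal.antidiagonal i)]
    refine Finset.sum_congr rfl fun p hp => ?_
    have hp' := Finset.HasAntidiagonal.mem_antidiagonal.1 hp
    have h1 := hq p.1 (by omega)
    have h2 := h p.2 (by omega) (fun t => x t.succ)
    calc _ = (i.choose p.1 : ℤ) * ((x 0 ^ p.1 * ∑ j, (α j : ℤ) * β j ^ p.1) *
          ∑ j, (a j : ℤ) * (∑ t, b j t * x t.succ) ^ p.2) := by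
          rw [Finset.mul_sum _ _ (x 0 ^ p.1), Finset.sum_mul_sum, Finset.mul_sum]
          refine Finset.sum_congr rfl fun j _ => ?_
          rw [Finset.mul_sum]
          refine Finset.sum_congr rfl fun l _ => ?_
          push_cast
          rw [mul_pow]
          ring
      _ = _ := by
          rw [h1, h2, ← mul_pow, gaussMomentVar_sq, ← Finset.mul_sum]
          push_cast
          ring

/-- **Hilbert's identity**: a positive multiple of `(x₁² + ⋯ + xₙ²) ^ K` is a sum of `2K`-th powers
of integral linear forms. -/
theorem hilbert_identity (K n : ℕ) :
    ∃ (ι : Type) (_ : Fintype ι) (a : ι → ℕ) (b : ι → Fin n → ℤ) (M : ℕ), 0 < M ∧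
      ∀ x : Fin n → ℤ,
        (M : ℤ) * (∑ t, x t ^ 2) ^ K = ∑ j, (a j : ℤ) * (∑ t, b j t * x t) ^ (2 * K) := by
  obtain ⟨ι, hι, a, b, M, d, hM, hd, h⟩ := exists_int_cubature (2 * K) n
  refine ⟨ι, hι, a, b, M * gaussMoment (2 * K) * (d ^ 2) ^ K, ?_, fun x => ?_⟩
  · have := gaussMoment_two_mul_pos K
    positivity
  · rw [h _ le_rfl, gaussMomentVar_two_mul, mul_pow]
    push_cast
    ring

/-! ### Sums of boundedly many powers -/

/-- `n` is a sum of at most `s` `m`-th powers. -/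
def IsSumPow (m s n : ℕ) : Prop :=
  ∃ l : Multiset ℕ, l.card ≤ s ∧ (l.map (· ^ m)).sum = n

theorem IsSumPow.zero (m s : ℕ) : IsSumPow m s 0 := ⟨0, by simp, by simp⟩

theorem IsSumPow.pow (m x : ℕ) : IsSumPow m 1 (x ^ m) := ⟨{x}, by simp, by simp⟩

theorem IsSumPow.add {m s t a b : ℕ} (ha : IsSumPow m s a) (hb : IsSumPow m t b) :
    IsSumPow m (s + t) (a + b) := by
  obtain ⟨l, hl, rfl⟩ := ha
  obtain ⟨l', hl', rfl⟩ := hb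
  exact ⟨l + l', by rw [Multiset.card_add]; omega, by simp⟩

theorem IsSumPow.mono {m s t a : ℕ} (ha : IsSumPow m s a) (h : s ≤ t) : IsSumPow m t a := by
  obtain ⟨l, hl, rfl⟩ := ha
  exact ⟨l, hl.trans h, rfl⟩

theorem IsSumPow.mul_left {m s a : ℕ} (ha : IsSumPow m s a) (c : ℕ) :
    IsSumPow m (c * s) (c * a) := by
  induction c with
  | zero => simpa using IsSumPow.zero m 0
  | succ c ih => rw [Nat.add_one_mul, Nat.add_one_mul]; exact ih.add ha

theorem IsSumPow.sum {ι : Type*} {m : ℕ} (t : Finset ι) {s a : ι → ℕ}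
    (h : ∀ i ∈ t, IsSumPow m (s i) (a i)) : IsSumPow m (∑ i ∈ t, s i) (∑ i ∈ t, a i) := by
  classical
  induction t using Finset.induction_on with
  | empty => simpa using IsSumPow.zero m 0
  | insert i t hi ih =>
    rw [Finset.sum_insert hi, Finset.sum_insert hi]
    exact (h i (Finset.mem_insert_self i t)).add
      (ih fun j hj => h j (Finset.mem_insert_of_mem hj))

theorem IsSumPow.multiset_sum {m s : ℕ} (l : Multiset ℕ) {f : ℕ → ℕ}
    (h : ∀ x ∈ l, IsSumPow m s (f x)) : IsSumPow m (l.card * s) (l.map f).sum := by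
  induction l using Multiset.induction_on with
  | empty => simpa using IsSumPow.zero m 0
  | cons a l ih =>
    rw [Multiset.card_cons, Multiset.map_cons, Multiset.sum_cons, Nat.add_one_mul,
      add_comm (f a)]
    exact (ih fun x hx => h x (Multiset.mem_cons_of_mem hx)).add (h a (Multiset.mem_cons_self a l))

theorem IsSumPow.one_le (m n : ℕ) : IsSumPow m n n := by
  simpa using (IsSumPow.pow m 1).mul_left n

theorem IsSumPow.of_two_mul {k s n : ℕ} (h : IsSumPow (2 * k) s n) : IsSumPow k s n := by
  obtain ⟨l, hl, rfl⟩ := h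
  refine ⟨l.map (· ^ 2), by simpa using hl, ?_⟩
  simp [pow_mul]

/-- Every natural number is a sum of boundedly many `m`-th powers. -/
def WaringHolds (m : ℕ) : Prop := ∃ s, ∀ n, IsSumPow m s n

/-- The remainder modulo c and the finitely many small multiples of c are sums of ones. -/
theorem waringHolds_of_mul {m c : ℕ} (hc : 0 < c) (s : ℕ) (n₀ : ℕ)
    (h : ∀ n, n₀ ≤ n → IsSumPow m s (c * n)) : WaringHolds m := by
  refine ⟨s + c * n₀ + c, fun n => ?_⟩
  have hr : IsSumPow m c (n % c) := (IsSumPow.one_le m _).mono (Nat.mod_lt n hc).le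
  rw [← Nat.div_add_mod n c]
  refine IsSumPow.add ?_ hr
  rcases le_total n₀ (n / c) with hn | hn
  · exact (h _ hn).mono (by omega)
  · exact (IsSumPow.one_le m _).mono
      ((Nat.mul_le_mul_left c hn).trans (Nat.le_add_left _ _))

theorem isSumPow_of_sum_eq {ι : Type*} [Fintype ι] {k : ℕ} (c : ι → ℕ) (y : ι → ℤ) (n : ℕ)
    (h : (n : ℤ) = ∑ j, (c j : ℤ) * y j ^ (2 * k)) : IsSumPow (2 * k) (∑ j, c j) n := by
  have hn : n = ∑ j, c j * (y j).natAbs ^ (2 * k) := by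
    zify
    rw [h]
    refine Finset.sum_congr rfl fun j _ => ?_
    rw [pow_mul, pow_mul, sq_abs]
  rw [hn]
  refine IsSumPow.sum _ fun j _ => ?_
  simpa using (IsSumPow.pow (2 * k) (y j).natAbs).mul_left (c j)

/-- Write n as a sum of powers N^k and each N as four squares; Hilbert's identity in four variables
turns M * N^k into boundedly many 2k-th powers. -/
theorem WaringHolds.two_mul {k : ℕ} (h : WaringHolds k) : WaringHolds (2 * k) := by
  obtain ⟨g, hg⟩ := h
  obtain ⟨ι, hι, a, b, M, hM, hid⟩ := hilbert_identity k 4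
  refine waringHolds_of_mul hM (g * ∑ j, a j) 0 fun n _ => ?_
  obtain ⟨l, hl, rfl⟩ := hg n
  rw [← Multiset.sum_map_mul_left]
  refine (IsSumPow.multiset_sum l (s := ∑ j, a j) fun N _ => ?_).mono (Nat.mul_le_mul_right _ hl)
  obtain ⟨x, y, z, w, hN⟩ := Nat.sum_four_squares N
  have h := hid ![x, y, z, w]
  refine isSumPow_of_sum_eq a (fun j => ∑ t, b j t * ![(x : ℤ), y, z, w] t) _ ?_
  rw [← h, ← hN]
  simp [Fin.sum_univ_four]

/-! ### Taylor coefficients of Hilbert's identity -/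

open Polynomial in
theorem coeff_C_add_C_mul_X_pow (r b : ℤ) (n i : ℕ) :
    ((C r + C b * X) ^ n).coeff i = b ^ i * r ^ (n - i) * n.choose i := by
  have h : (C r + C b * X) ^ n = ((X + C r) ^ n).comp (C b * X) := by
    simp [add_comm]
  rw [h, comp_C_mul_X_coeff, coeff_X_add_C_pow]
  ring

open Polynomial in
/-- The even Taylor coefficients at `x` of `(U + x ^ 2) ^ (k + l)`, with `T = U + x ^ 2`. -/
theorem coeff_sq_add_pow (T x : ℤ) {k l : ℕ} (hl : l ≤ k) :
    ((C T + X * (X + C (2 * x))) ^ (k + l)).coeff (2 * l) =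
      ∑ i ∈ Finset.range (l + 1),
        ((k + l).choose (l + i) * (l + i).choose (l - i) * 4 ^ i : ℕ) *
          (x ^ (2 * i) * T ^ (k - i)) := by
  rw [add_comm (C T), add_pow, finsetSum_coeff]
  have hterm : ∀ j, (((X * (X + C (2 * x))) ^ j * C T ^ (k + l - j) *
      ((k + l).choose j : ℤ[X])).coeff (2 * l)) =
      if j ≤ 2 * l then (2 * x) ^ (j - (2 * l - j)) * j.choose (2 * l - j) * T ^ (k + l - j) *
        (k + l).choose j else 0 := fun j => by
    rw [← C_eq_natCast, ← C_pow, coeff_mul_C, coeff_mul_C, mul_pow, coeff_X_pow_mul',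
      coeff_X_add_C_pow]
    split_ifs <;> simp
  simp_rw [hterm]
  have hsub : Finset.Ico l (2 * l + 1) ⊆ Finset.range (k + l + 1) := fun j hj => by
    rw [Finset.mem_Ico] at hj
    rw [Finset.mem_range]
    omega
  rw [← Finset.sum_subset hsub, Finset.sum_Ico_eq_sum_range, show 2 * l + 1 - l = l + 1 by omega]
  · refine Finset.sum_congr rfl fun i hi => ?_
    rw [Finset.mem_range] at hi
    rw [if_pos (by omega), show 2 * l - (l + i) = l - i by omega,
      show l + i - (l - i) = 2 * i by omega, show k + l - (l + i) = k - i by omega, mul_pow,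
      pow_mul 2]
    push_cast
    ring
  · intro j _ hj
    rw [Finset.mem_Ico, not_and_or, not_le, not_lt] at hj
    split_ifs with h
    · rw [Nat.choose_eq_zero_of_lt (by omega)]
      simp
    · rfl

/-- Put x + h and four squares summing to T - x² into Hilbert's identity of exponent k + l, and
compare coefficients of h^(2l). On the right these are 2k-th powers with nonnegative weights, since
the h-coefficients enter to the even power 2l. -/
theorem exists_isSumPow_taylor {k l : ℕ} (hl : l ≤ k) :
    ∃ (A : ℕ → ℕ) (s : ℕ), 0 < A l ∧ ∀ x T : ℕ, x ^ 2 ≤ T →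
      IsSumPow (2 * k) s (∑ i ∈ Finset.range (l + 1), A i * (x ^ (2 * i) * T ^ (k - i))) := by
  obtain ⟨ι, hι, a, b, M, hM, hid⟩ := hilbert_identity (k + l) 5
  refine ⟨fun i => M * ((k + l).choose (l + i) * (l + i).choose (l - i) * 4 ^ i),
    ∑ j, a j * (2 * (k + l)).choose (2 * l) * (b j 4 ^ 2).toNat ^ l, ?_, fun x T hT => ?_⟩
  · have h1 : 0 < (k + l).choose (l + l) := Nat.choose_pos (by omega)
    have h2 : 0 < (l + l).choose (l - l) := Nat.choose_pos (by omega)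
    positivity
  obtain ⟨u, v, w, z, hU⟩ := Nat.sum_four_squares (T - x ^ 2)
  have hT' : (T : ℤ) = u ^ 2 + v ^ 2 + w ^ 2 + z ^ 2 + x ^ 2 := by
    have : T = u ^ 2 + v ^ 2 + w ^ 2 + z ^ 2 + x ^ 2 := by omega
    exact_mod_cast this
  set r : ι → ℤ := fun j => b j 0 * u + b j 1 * v + b j 2 * w + b j 3 * z + b j 4 * x with hr
  have hpoly : Polynomial.C (M : ℤ) * (Polynomial.C (T : ℤ) +
      Polynomial.X * (Polynomial.X + Polynomial.C (2 * (x : ℤ)))) ^ (k + l) =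
      ∑ j, Polynomial.C (a j : ℤ) *
        (Polynomial.C (r j) + Polynomial.C (b j 4) * Polynomial.X) ^ (2 * (k + l)) := by
    refine Polynomial.funext fun h => ?_
    have h5 := hid ![u, v, w, z, x + h]
    simp only [Fin.sum_univ_five, Polynomial.eval_mul, Polynomial.eval_pow, Polynomial.eval_add,
      Polynomial.eval_C, Polynomial.eval_X, Polynomial.eval_finsetSum] at h5 ⊢
    simp only [Matrix.cons_val] at h5
    convert! h5 using 3
    · rw [hT']; ring
    · rw [hr]; ring
  have hcoeff := congrArg (fun p => p.coeff (2 * l)) hpoly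
  simp only [Polynomial.coeff_C_mul, Polynomial.finsetSum_coeff, coeff_sq_add_pow _ _ hl,
    coeff_C_add_C_mul_X_pow] at hcoeff
  refine isSumPow_of_sum_eq _ r _ ?_
  push_cast at hcoeff ⊢
  simp_rw [mul_assoc (M : ℤ)]
  rw [← Finset.mul_sum, hcoeff]
  refine Finset.sum_congr rfl fun j _ => ?_
  rw [show 2 * (k + l) - 2 * l = 2 * k by omega, Int.toNat_of_nonneg (sq_nonneg _), pow_mul]
  ring

/-- A positive multiple of `x ^ (2l) * T ^ (k - l)`, up to terms of lower degree in `x`, is a sum of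
boundedly many `2k`-th powers. -/
theorem exists_isSumPow_lower_terms {k l : ℕ} (hl : l ≤ k) :
    ∃ (c : ℕ) (B : ℕ → ℕ) (s : ℕ), 0 < c ∧ ∀ x T : ℕ, x ^ 2 ≤ T →
      IsSumPow (2 * k) s (c * (x ^ (2 * l) * T ^ (k - l) +
        ∑ i ∈ Finset.range l, B i * (x ^ (2 * i) * T ^ (k - i)))) := by
  obtain ⟨A, s, hA, h⟩ := exists_isSumPow_taylor hl
  -- Replacing T by A l * T makes every coefficient divisible by the leading one, A l ^ (k - l + 1).
  refine ⟨A l ^ (k - l + 1), fun i => A i * A l ^ (l - 1 - i), s, by positivity, fun x T hT => ?_⟩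
  convert! h x (A l * T) (hT.trans (Nat.le_mul_of_pos_left T hA)) using 1
  rw [Finset.sum_range_succ, mul_add, Finset.mul_sum, add_comm]
  congr 1
  · refine Finset.sum_congr rfl fun i hi => ?_
    rw [Finset.mem_range] at hi
    rw [mul_pow, show k - i = (k - l + 1) + (l - 1 - i) by omega, pow_add (A l)]
    ring
  · rw [mul_pow]
    ring

/-! ### Digits in base T and the Hilbert–Waring theorem -/

/-- Write the digit C as a sum of 2l-th powers x^(2l), where C < T forces x² ≤ T, and add up the
preceding identities. The lower terms in x only affect higher digits. -/
theorem exists_isSumPow_digit {k l : ℕ} (hl0 : 1 ≤ l) (hl : l ≤ k) (h : WaringHolds (2 * l)) :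
    ∃ c E s : ℕ, 0 < c ∧ ∀ T C : ℕ, C < T → ∃ D,
      C * T ^ (k - l) + D * T ^ (k - l + 1) ≤ E * T ^ k ∧
      IsSumPow (2 * k) s (c * (C * T ^ (k - l) + D * T ^ (k - l + 1))) := by
  obtain ⟨g, hg⟩ := h
  obtain ⟨c, B, s, hc, hs⟩ := exists_isSumPow_lower_terms hl
  refine ⟨c, g * (1 + ∑ i ∈ Finset.range l, B i), g * s, hc, fun T C hC => ?_⟩
  obtain ⟨L, hL, hsum⟩ := hg C
  have hx : ∀ x ∈ L, x ^ 2 ≤ T := fun x hx => by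
    have h1 : x ^ (2 * l) ≤ C :=
      hsum ▸ Multiset.le_sum_of_mem (Multiset.mem_map_of_mem (· ^ (2 * l)) hx)
    rw [pow_mul] at h1
    exact ((Nat.le_self_pow (by omega) _).trans h1).trans hC.le
  have hterm : ∀ i ≤ l, ∀ x ∈ L, x ^ (2 * i) * T ^ (k - i) ≤ T ^ k := fun i hi x hxL => by
    calc x ^ (2 * i) * T ^ (k - i) ≤ T ^ i * T ^ (k - i) := by
          rw [pow_mul]; exact Nat.mul_le_mul_right _ (Nat.pow_le_pow_left (hx x hxL) i)
      _ = T ^ k := by rw [← pow_add, Nat.add_sub_cancel' (hi.trans hl)]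
  have hV : C * T ^ (k - l) + (L.map fun x => ∑ i ∈ Finset.range l,
        B i * (x ^ (2 * i) * T ^ (l - 1 - i))).sum * T ^ (k - l + 1) =
      (L.map fun x => x ^ (2 * l) * T ^ (k - l) +
        ∑ i ∈ Finset.range l, B i * (x ^ (2 * i) * T ^ (k - i))).sum := by
    rw [Multiset.sum_map_add, Multiset.sum_map_mul_right, hsum, ← Multiset.sum_map_mul_right]
    refine congrArg (fun S => _ + Multiset.sum S) (Multiset.map_congr rfl fun x _ => ?_)
    rw [Finset.sum_mul]
    refine Finset.sum_congr rfl fun i hi => ?_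
    rw [Finset.mem_range] at hi
    rw [show k - i = (l - 1 - i) + (k - l + 1) by omega, pow_add]
    ring
  refine ⟨(L.map fun x => ∑ i ∈ Finset.range l, B i * (x ^ (2 * i) * T ^ (l - 1 - i))).sum,
    ?_, ?_⟩
  · rw [hV]
    refine (Multiset.sum_le_card_nsmul _ ((1 + ∑ i ∈ Finset.range l, B i) * T ^ k) ?_).trans ?_
    · intro y hy
      obtain ⟨x, hxL, rfl⟩ := Multiset.mem_map.1 hy
      rw [add_mul, one_mul, Finset.sum_mul]
      refine add_le_add (hterm l le_rfl x hxL) (Finset.sum_le_sum fun i hi => ?_)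
      exact Nat.mul_le_mul_left _ (hterm i (Finset.mem_range.1 hi).le x hxL)
    · rw [Multiset.card_map, smul_eq_mul, ← mul_assoc]
      exact Nat.mul_le_mul_right _ (Nat.mul_le_mul_right _ hL)
  · rw [hV, ← Multiset.sum_map_mul_left]
    exact (IsSumPow.multiset_sum L fun x hxL => hs x T (hx x hxL)).mono (Nat.mul_le_mul_right _ hL)

theorem exists_isSumPow_modEq {k : ℕ} (h : ∀ l, 1 ≤ l → l < k → WaringHolds (2 * l)) (j : ℕ)
    (hj : j < k) : ∃ c E s : ℕ, 0 < c ∧ ∀ T, 1 ≤ T → ∀ r, T ∣ r → ∃ V,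
      V ≡ r [MOD T ^ (j + 1)] ∧ V ≤ E * T ^ k ∧ IsSumPow (2 * k) s (c * V) := by
  induction j with
  | zero =>
    refine ⟨1, 0, 0, one_pos, fun T _ r hr => ⟨0, ?_, Nat.zero_le _, IsSumPow.zero _ _⟩⟩
    rw [zero_add, pow_one]
    exact ((Nat.modEq_zero_iff_dvd).2 hr).symm
  | succ j ih =>
    obtain ⟨c₁, E₁, s₁, hc₁, h₁⟩ := ih (by omega)
    -- This l places the digit at T^(j+1), where it corrects V without disturbing its residue modulo
    -- T^(j+1).
    obtain ⟨c₂, E₂, s₂, hc₂, h₂⟩ := exists_isSumPow_digit (k := k) (l := k - (j + 1)) (by omega)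
      (by omega) (h _ (by omega) (by omega))
    rw [Nat.sub_sub_self hj.le] at h₂
    refine ⟨c₁ * c₂, E₁ + E₂, c₂ * s₁ + c₁ * s₂, Nat.mul_pos hc₁ hc₂, fun T hT r hr => ?_⟩
    obtain ⟨V, hV, hVE, hVs⟩ := h₁ T hT r hr
    obtain ⟨q, hq⟩ := (Nat.modEq_iff_dvd).1 hV
    have hT' : (T : ℤ) ≠ 0 := by positivity
    have hlt : (q % T).toNat < T := by
      have h1 := Int.emod_lt_of_pos q (b := T) (by positivity)
      have h2 := Int.emod_nonneg q hT'
      omega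
    obtain ⟨D, hDE, hDs⟩ := h₂ T _ hlt
    refine ⟨V + ((q % T).toNat * T ^ (j + 1) + D * T ^ (j + 1 + 1)), ?_, ?_, ?_⟩
    · rw [Nat.modEq_iff_dvd]
      refine ⟨q / T - D, ?_⟩
      push_cast at hq ⊢
      rw [Int.toNat_of_nonneg (Int.emod_nonneg q hT')]
      linear_combination hq - (T : ℤ) ^ (j + 1) * Int.emod_add_mul_ediv q T
    · rw [add_mul]
      exact add_le_add hVE hDE
    · convert! (hVs.mul_left c₂).add (hDs.mul_left c₁) using 1
      ring

theorem exists_isSumPow_of_dvd {k : ℕ} (hk : 1 ≤ k)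
    (h : ∀ l, 1 ≤ l → l < k → WaringHolds (2 * l)) :
    ∃ c E : ℕ, 0 < c ∧ ∀ F, ∃ s, ∀ T, 1 ≤ T → ∀ N, T ∣ N → E * T ^ k ≤ N → N ≤ F * T ^ k →
      IsSumPow k s (c * N) := by
  obtain ⟨c, E, s, hc, h⟩ := exists_isSumPow_modEq h (k - 1) (by omega)
  rw [Nat.sub_add_cancel hk] at h
  refine ⟨c, E, hc, fun F => ⟨s + c * F, fun T hT N hTN hE hF => ?_⟩⟩
  obtain ⟨V, hV, hVE, hVs⟩ := h T hT N hTN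
  obtain ⟨q, hq⟩ := (Nat.modEq_iff_dvd' (hVE.trans hE)).1 hV
  have hN : N = V + q * T ^ k := by
    have := hVE.trans hE
    rw [mul_comm]
    omega
  have hqF : q ≤ F := by
    refine le_of_mul_le_mul_right (a := T ^ k) ?_ (by positivity)
    omega
  rw [hN, mul_add]
  refine hVs.of_two_mul.add ?_
  have h1 := ((IsSumPow.pow k T).mul_left q).mul_left c
  rw [mul_one] at h1
  exact h1.mono (Nat.mul_le_mul_left c hqF)

/-- The divisibility condition is removed by splitting n into a multiple of T and a multiple of the
coprime T + 1, both of order T^k. -/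
theorem waringHolds_of_lt {k : ℕ} (hk : 2 ≤ k) (h : ∀ l, 1 ≤ l → l < k → WaringHolds l) :
    WaringHolds k := by
  obtain ⟨c, E, hc, hE⟩ := exists_isSumPow_of_dvd (k := k) (by omega)
    fun l h1 h2 => (h l h1 h2).two_mul
  -- The factor 3^k comes from T + 2 ≤ 3T; the threshold with 2^k guarantees T ≥ 1.
  obtain ⟨s, hs⟩ := hE ((2 * E + 1) * 3 ^ k)
  refine waringHolds_of_mul hc (s + s) ((2 * E + 1) * 2 ^ k) fun n hn => ?_
  have hex : ∃ T, n < (2 * E + 1) * (T + 2) ^ k :=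
    ⟨n, calc n < n + 2 := by omega
      _ ≤ (n + 2) ^ k := Nat.le_self_pow (by omega) _
      _ ≤ (2 * E + 1) * (n + 2) ^ k := Nat.le_mul_of_pos_left _ (by omega)⟩
  obtain ⟨T, hT, hmin⟩ : ∃ T, n < (2 * E + 1) * (T + 2) ^ k ∧
      ∀ S < T, (2 * E + 1) * (S + 2) ^ k ≤ n :=
    ⟨Nat.find hex, Nat.find_spec hex, fun S hS => not_lt.1 (Nat.find_min hex hS)⟩
  have hT1 : 1 ≤ T := by
    by_contra h0
    rw [show T = 0 by omega, zero_add] at hT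
    omega
  have hlow : (2 * E + 1) * (T + 1) ^ k ≤ n := by
    have := hmin (T - 1) (by omega)
    rwa [show T - 1 + 2 = T + 1 by omega] at this
  have hpow : (T + 1) ^ k = (T + 1) * (T + 1) ^ (k - 1) := by
    rw [← pow_succ', Nat.sub_add_cancel (by omega)]
  have hsq : (T + 1) * T ≤ (T + 1) ^ k := by
    rw [hpow]
    exact Nat.mul_le_mul_left _
      ((Nat.le_succ T).trans (Nat.le_self_pow (n := k - 1) (by omega) (T + 1)))
  -- Here w makes the second summand (T + 1)(w + r) large enough, and r makes the first divisible by
  -- T, because T + 1 ≡ 1. The second is at most (E + 1)(T + 1)^k, leaving at least E(T + 1)^k for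
  -- the first.
  set w := E * (T + 1) ^ (k - 1) with hw
  have hEw : (T + 1) * w = E * (T + 1) ^ k := by rw [hw, hpow]; ring
  have hwn : w ≤ n := by nlinarith
  have hr : (n - w) % T < T := Nat.mod_lt _ hT1
  set r := (n - w) % T with hrdef
  have hN₂ : (T + 1) * (w + r) ≤ (E + 1) * (T + 1) ^ k := by
    have : (T + 1) * r ≤ (T + 1) * T := Nat.mul_le_mul_left _ hr.le
    nlinarith
  have hle : (T + 1) * (w + r) ≤ n := by nlinarith
  have hmono : T ^ k ≤ (T + 1) ^ k := Nat.pow_le_pow_left (Nat.le_succ T) k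
  have h3 : 1 ≤ 3 ^ k := Nat.one_le_pow _ _ (by norm_num)
  have hn_split : n = (n - (T + 1) * (w + r)) + (T + 1) * (w + r) := (Nat.sub_add_cancel hle).symm
  rw [hn_split, mul_add]
  refine (hs T hT1 _ ?_ ?_ ?_).add (hs (T + 1) (by omega) _ (Dvd.intro _ rfl) ?_ ?_)
  · have hdm := Nat.div_add_mod (n - w) T
    have : n - (T + 1) * (w + r) = T * ((n - w) / T) - T * (w + r) := by
      rw [add_mul, one_mul]
      omega
    rw [this]
    exact Nat.dvd_sub (Dvd.intro _ rfl) (Dvd.intro _ rfl)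
  · refine Nat.le_sub_of_add_le ?_
    nlinarith
  · calc n - (T + 1) * (w + r) ≤ (2 * E + 1) * (T + 2) ^ k := (Nat.sub_le _ _).trans hT.le
      _ ≤ (2 * E + 1) * (3 * T) ^ k :=
        Nat.mul_le_mul_left _ (Nat.pow_le_pow_left (by omega) k)
      _ = (2 * E + 1) * 3 ^ k * T ^ k := by rw [mul_pow, mul_assoc]
  · rw [← hEw]
    exact Nat.mul_le_mul_left _ (Nat.le_add_right _ _)
  · refine hN₂.trans (Nat.mul_le_mul_right _ ?_)
    nlinarith

/-- **Hilbert–Waring theorem**. -/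
theorem waringHolds (k : ℕ) (hk : 1 ≤ k) : WaringHolds k := by
  induction k using Nat.strong_induction_on with
  | _ k ih =>
    rcases hk.eq_or_lt with rfl | hk
    · exact ⟨1, fun n => by simpa using IsSumPow.pow 1 n⟩
    · exact waringHolds_of_lt hk fun l h1 h2 => ih l h2 h1

theorem IsSumPow.exists_fin {m : ℕ} (hm : m ≠ 0) {s n : ℕ} (h : IsSumPow m s n) :
    ∃ x : Fin s → ℕ, ∑ i, x i ^ m = n := by
  obtain ⟨l, hl, rfl⟩ := h
  induction s generalizing l with
  | zero => exact ⟨0, by simp [Multiset.card_eq_zero.1 (Nat.le_zero.1 hl)]⟩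
  | succ s ih =>
    induction l using Multiset.induction_on with
    | empty => exact ⟨0, by simp [hm]⟩
    | cons a l _ =>
      obtain ⟨x, hx⟩ := ih l (by rw [Multiset.card_cons] at hl; omega)
      exact ⟨Fin.cons a x, by simp [Fin.sum_univ_succ, hx]⟩

/-- Hilbert–Waring makes the set in `waringG` nonempty, so its infimum is attained. -/
theorem waringG_spec {m : ℕ} (hm : m ≠ 0) (N : ℕ) : ∃ x : Fin (waringG m) → ℕ, ∑ i, x i ^ m = N := by
  have hne : {k : ℕ | ∀ N : ℕ, 0 < N → ∃ x : Fin k → ℕ, ∑ i, x i ^ m = N}.Nonempty := by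
    obtain ⟨s, hs⟩ := waringHolds m (Nat.one_le_iff_ne_zero.2 hm)
    exact ⟨s, fun N _ => (hs N).exists_fin hm⟩
  rcases N.eq_zero_or_pos with rfl | hN
  · exact ⟨0, by simp [hm]⟩
  · exact Nat.sInf_mem hne N hN

/-! ### The separated form and its values -/

/-- The form `∑ eᵢ xᵢ ^ m + (B + 1) ∑_{i ≠ j} xᵢ ^ 2 xⱼ ^ (m - 2) + (B + 1) ∑ zⱼ ^ m` in the
variables `x₁, …, x_B` and `z₁, …, z_g`. -/
noncomputable def separatedForm (m B g : ℕ) (e : Fin B → ℕ) : MvPolynomial (Fin (B + g)) ℤ :=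
  ∑ i, MvPolynomial.C (e i : ℤ) * MvPolynomial.X (Fin.castAdd g i) ^ m +
  MvPolynomial.C ((B : ℤ) + 1) * ∑ p ∈ (Finset.univ : Finset (Fin B)).offDiag,
    MvPolynomial.X (Fin.castAdd g p.1) ^ 2 * MvPolynomial.X (Fin.castAdd g p.2) ^ (m - 2) +
  MvPolynomial.C ((B : ℤ) + 1) * ∑ j, MvPolynomial.X (Fin.natAdd B j) ^ m

theorem aeval_separatedForm {R : Type*} [CommRing R] (m B g : ℕ) (e : Fin B → ℕ)
    (x : Fin (B + g) → R) :
    MvPolynomial.aeval x (separatedForm m B g e) =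
      ∑ i, (e i : R) * x (Fin.castAdd g i) ^ m +
      ((B : R) + 1) * ∑ p ∈ (Finset.univ : Finset (Fin B)).offDiag,
        x (Fin.castAdd g p.1) ^ 2 * x (Fin.castAdd g p.2) ^ (m - 2) +
      ((B : R) + 1) * ∑ j, x (Fin.natAdd B j) ^ m := by
  simp [separatedForm]

theorem eval_separatedForm (m B g : ℕ) (e : Fin B → ℕ) (x : Fin (B + g) → ℤ) :
    MvPolynomial.eval x (separatedForm m B g e) =
      ∑ i, (e i : ℤ) * x (Fin.castAdd g i) ^ m +
      ((B : ℤ) + 1) * ∑ p ∈ (Finset.univ : Finset (Fin B)).offDiag,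
        x (Fin.castAdd g p.1) ^ 2 * x (Fin.castAdd g p.2) ^ (m - 2) +
      ((B : ℤ) + 1) * ∑ j, x (Fin.natAdd B j) ^ m := by
  simp [separatedForm]

theorem isHomogeneous_separatedForm {m : ℕ} (hm : 2 < m) (B g : ℕ) (e : Fin B → ℕ) :
    (separatedForm m B g e).IsHomogeneous m := by
  refine ((MvPolynomial.IsHomogeneous.sum _ _ _ fun i _ => ?_).add
    (MvPolynomial.IsHomogeneous.C_mul (MvPolynomial.IsHomogeneous.sum _ _ _ fun p _ => ?_) _)).add
    (MvPolynomial.IsHomogeneous.C_mul (MvPolynomial.IsHomogeneous.sum _ _ _ fun j _ => ?_) _)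
  · exact (MvPolynomial.isHomogeneous_X_pow _ _).C_mul _
  · have h := (MvPolynomial.isHomogeneous_X_pow (R := ℤ) (Fin.castAdd g p.1) 2).mul
      (MvPolynomial.isHomogeneous_X_pow (Fin.castAdd g p.2) (m - 2))
    rwa [Nat.add_sub_cancel' hm.le] at h
  · exact MvPolynomial.isHomogeneous_X_pow _ _

theorem isPosDefForm_separatedForm {m : ℕ} (hm : 2 < m) (heven : Even m) (B g : ℕ)
    {e : Fin B → ℕ} (he : ∀ i, 0 < e i) : IsPosDefForm m (separatedForm m B g e) := by
  have heven' : Even (m - 2) := (Nat.even_sub hm.le).2 (by simp [heven])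
  refine ⟨isHomogeneous_separatedForm hm B g e, fun x hx => ?_⟩
  rw [aeval_separatedForm]
  have h1 : ∀ i ∈ Finset.univ, 0 ≤ (e i : ℝ) * x (Fin.castAdd g i) ^ m := fun i _ =>
    mul_nonneg (Nat.cast_nonneg _) (heven.pow_nonneg _)
  have h2 : 0 ≤ ∑ p ∈ (Finset.univ : Finset (Fin B)).offDiag,
      x (Fin.castAdd g p.1) ^ 2 * x (Fin.castAdd g p.2) ^ (m - 2) :=
    Finset.sum_nonneg fun p _ => mul_nonneg (sq_nonneg _) (heven'.pow_nonneg _)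
  have h3 : ∀ j ∈ Finset.univ, 0 ≤ x (Fin.natAdd B j) ^ m := fun j _ => heven.pow_nonneg _
  have h1' := Finset.sum_nonneg h1
  have h3' := Finset.sum_nonneg h3
  obtain ⟨t, ht⟩ := Function.ne_iff.1 hx
  induction t using Fin.addCases with
  | left i =>
    have : 0 < ∑ i, (e i : ℝ) * x (Fin.castAdd g i) ^ m :=
      Finset.sum_pos' h1 ⟨i, Finset.mem_univ i,
        mul_pos (Nat.cast_pos.2 (he i)) (heven.pow_pos ht)⟩
    positivity
  | right j =>
    have : 0 < ∑ j, x (Fin.natAdd B j) ^ m :=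
      Finset.sum_pos' h3 ⟨j, Finset.mem_univ j, heven.pow_pos ht⟩
    positivity

/-- The small values of a separated form are those of its diagonal terms. -/
theorem eq_mul_pow_of_eval_separatedForm_le {m : ℕ} (hm : 2 < m) (heven : Even m) {B g : ℕ}
    {e : Fin B → ℕ} {x : Fin (B + g) → ℤ}
    (hx : MvPolynomial.eval x (separatedForm m B g e) ≤ B)
    (hpos : 0 < MvPolynomial.eval x (separatedForm m B g e)) :
    ∃ (i : Fin B) (b : ℤ), MvPolynomial.eval x (separatedForm m B g e) = e i * b ^ m := by
  have heven' : Even (m - 2) := (Nat.even_sub hm.le).2 (by simp [heven])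
  rw [eval_separatedForm] at *
  have h1 : 0 ≤ ∑ i, (e i : ℤ) * x (Fin.castAdd g i) ^ m := Finset.sum_nonneg fun i _ =>
    mul_nonneg (Nat.cast_nonneg _) (heven.pow_nonneg _)
  have h2 : ∀ p ∈ (Finset.univ : Finset (Fin B)).offDiag,
      0 ≤ x (Fin.castAdd g p.1) ^ 2 * x (Fin.castAdd g p.2) ^ (m - 2) :=
    fun p _ => mul_nonneg (sq_nonneg _) (heven'.pow_nonneg _)
  have h3 : 0 ≤ ∑ j, x (Fin.natAdd B j) ^ m := Finset.sum_nonneg fun j _ => heven.pow_nonneg _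
  have h2' := Finset.sum_nonneg h2
  -- A nonzero nonnegative integer here would contribute at least B + 1; the same applies to the
  -- mixed terms.
  have hz : ∑ j, x (Fin.natAdd B j) ^ m = 0 := by
    by_contra h
    have : 1 ≤ ∑ j, x (Fin.natAdd B j) ^ m := by omega
    nlinarith
  have hc : ∑ p ∈ (Finset.univ : Finset (Fin B)).offDiag,
      x (Fin.castAdd g p.1) ^ 2 * x (Fin.castAdd g p.2) ^ (m - 2) = 0 := by
    by_contra h
    have : 1 ≤ ∑ p ∈ (Finset.univ : Finset (Fin B)).offDiag,
      x (Fin.castAdd g p.1) ^ 2 * x (Fin.castAdd g p.2) ^ (m - 2) := by omega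
    nlinarith
  rw [hz, hc] at hpos ⊢
  rw [Finset.sum_eq_zero_iff_of_nonneg h2] at hc
  simp only [mul_zero, add_zero] at hpos ⊢
  obtain ⟨i, _, hi⟩ := Finset.exists_ne_zero_of_sum_ne_zero hpos.ne'
  refine ⟨i, x (Fin.castAdd g i), Finset.sum_eq_single i (fun j _ hj => ?_) (by simp)⟩
  have h := hc (i, j) (by simpa using hj.symm)
  have hi0 : x (Fin.castAdd g i) ≠ 0 := fun h0 => hi (by rw [h0, zero_pow (by omega), mul_zero])
  have hj0 : x (Fin.castAdd g j) = 0 :=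
    eq_zero_of_pow_eq_zero ((mul_eq_zero.1 h).resolve_left (pow_ne_zero 2 hi0))
  rw [hj0, zero_pow (by omega), mul_zero]

theorem represents_separatedForm {m : ℕ} (hm : 2 < m) {B : ℕ} (e : Fin B → ℕ) (q : ℕ) :
    Represents (separatedForm m B (waringG m) e) (((B + 1) * q : ℕ) : ℤ) ∧
    ∀ i, Represents (separatedForm m B (waringG m) e) ((e i + (B + 1) * q : ℕ) : ℤ) := by
  obtain ⟨z, hz⟩ := waringG_spec (m := m) (by omega) q
  constructor
  · refine ⟨Fin.append 0 fun j => (z j : ℤ), ?_⟩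
    rw [eval_separatedForm, ← hz]
    simp [show m ≠ 0 by omega]
  · intro i
    refine ⟨Fin.append (Pi.single i 1) fun j => (z j : ℤ), ?_⟩
    rw [eval_separatedForm, ← hz]
    have hcross : ∀ p ∈ (Finset.univ : Finset (Fin B)).offDiag,
        (Pi.single i 1 : Fin B → ℤ) p.1 ^ 2 * (Pi.single i 1 : Fin B → ℤ) p.2 ^ (m - 2) = 0 := by
      rintro ⟨j, k⟩ hp
      rw [Finset.mem_offDiag] at hp
      by_cases hj : j = i
      · have hk : k ≠ i := fun h => hp.2.2 (hj.trans h.symm)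
        simp [hk, show m - 2 ≠ 0 by omega]
      · simp [hj]
    simp only [Fin.append_left, Fin.append_right]
    rw [Finset.sum_eq_zero hcross, Finset.sum_eq_single i]
    · simp
    · intro j _ hj
      simp [hj, show m ≠ 0 by omega]
    · simp

theorem exists_form_of_closed {m : ℕ} (hm : 2 < m) (heven : Even m) (A : Finset ℤ)
    (hA : ∀ a ∈ A, 0 < a) (hclosed : ∀ a b : ℤ, a * b ^ m ∈ A → a ∈ A) :
    ∃ (n : ℕ) (Q : MvPolynomial (Fin n) ℤ), IsPosDefForm m Q ∧ RepresentsExactlyCompl Q A ∧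
      n < (largestElement A + 1) * (waringG m + 1) := by
  have hB : ∀ a ∈ A, a ≤ (largestElement A : ℤ) := fun a ha =>
    (largestElement_isGreatest A hA ⟨a, ha⟩).2 ha
  set B := largestElement A
  -- Indices are shifted: i stands for the residue i + 1. Adding B + 1 keeps the residue but exceeds
  -- every element of A.
  let e : Fin B → ℕ := fun i => if (i.val + 1 : ℤ) ∈ A then B + 1 + (i.val + 1) else i.val + 1
  have he : ∀ i, 0 < e i := fun i => by
    simp only [e]
    split_ifs <;> omega
  have heA : ∀ i, (e i : ℤ) ∉ A := fun i => by
    simp only [e]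
    split_ifs with h
    · intro h'
      have := hB _ h'
      push_cast at this
      omega
    · exact_mod_cast h
  have hpd := isPosDefForm_separatedForm hm heven B (waringG m) he
  refine ⟨B + waringG m, separatedForm m B (waringG m) e, hpd, fun a => ⟨?_, ?_⟩, by nlinarith⟩
  · rintro ⟨x, rfl⟩
    refine ⟨?_, fun hmem => ?_⟩
    · by_cases hx : x = 0
      · rw [hx, eval_separatedForm]
        simp [show m ≠ 0 by omega]
      · have h := hpd.pos (fun i => (x i : ℝ)) fun h => hx (funext fun i => by
          simpa using congrFun h i)
        rw [aeval_separatedForm] at h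
        rw [eval_separatedForm]
        exact_mod_cast h.le
    · obtain ⟨i, b, h⟩ := eq_mul_pow_of_eval_separatedForm_le hm heven (hB _ hmem) (hA _ hmem)
      rw [h] at hmem
      exact heA i (hclosed _ _ hmem)
  · rintro ⟨ha0, haA⟩
    lift a to ℕ using ha0
    have hdm := Nat.div_add_mod a (B + 1)
    have hlt : a % (B + 1) < B + 1 := Nat.mod_lt a (Nat.succ_pos B)
    rcases Nat.eq_zero_or_pos (a % (B + 1)) with h0 | h0
    · have h := (represents_separatedForm hm e (a / (B + 1))).1
      rwa [show (B + 1) * (a / (B + 1)) = a by omega] at h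
    · let i : Fin B := ⟨a % (B + 1) - 1, by omega⟩
      have hi : i.val + 1 = a % (B + 1) := Nat.sub_add_cancel h0
      by_cases hmem : (i.val + 1 : ℤ) ∈ A
      · have h := (represents_separatedForm hm e (a / (B + 1) - 1)).2 i
        -- If the quotient were 0, a would be its own residue, which lies in A; so one B + 1 is
        -- available for e i to absorb.
        have hq : a / (B + 1) ≠ 0 := fun hq => haA (by
          rw [hq] at hdm
          rw [← hdm, ← hi]
          simpa using hmem)
        have hei : e i = B + 1 + (i.val + 1) := if_pos hmem
        have hmul : (B + 1) * (a / (B + 1)) = (B + 1) * (a / (B + 1) - 1) + (B + 1) := by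
          rw [← Nat.mul_succ, Nat.succ_eq_add_one, Nat.sub_add_cancel (Nat.pos_of_ne_zero hq)]
        rwa [show e i + (B + 1) * (a / (B + 1) - 1) = a by omega] at h
      · have h := (represents_separatedForm hm e (a / (B + 1))).2 i
        have hei : e i = i.val + 1 := if_neg hmem
        rwa [show e i + (B + 1) * (a / (B + 1)) = a by omega] at h

/-! ### Necessity and finite criterion sets -/

theorem eval_smul_of_isHomogeneous {σ R : Type*} [CommSemiring R] {Q : MvPolynomial σ R} {m : ℕ}
    (hQ : Q.IsHomogeneous m) (b : R) (x : σ → R) :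
    MvPolynomial.eval (b • x) Q = b ^ m * MvPolynomial.eval x Q := by
  rw [MvPolynomial.eval_eq, MvPolynomial.eval_eq, Finset.mul_sum]
  refine Finset.sum_congr rfl fun d hd => ?_
  have hd' := hQ (MvPolynomial.mem_support_iff.1 hd)
  rw [Finsupp.weight_apply] at hd'
  simp only [Pi.one_apply, smul_eq_mul, mul_one, Finsupp.sum] at hd'
  simp only [Pi.smul_apply, smul_eq_mul, mul_pow, Finset.prod_mul_distrib,
    Finset.prod_pow_eq_pow_sum]
  rw [hd']
  ring

theorem closed_of_representsExactlyCompl {m n : ℕ} (heven : Even m) {A : Finset ℤ}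
    (hA : ∀ a ∈ A, 0 < a) {Q : MvPolynomial (Fin n) ℤ} (hQ : Q.IsHomogeneous m)
    (h : RepresentsExactlyCompl Q A) (a b : ℤ) (hab : a * b ^ m ∈ A) : a ∈ A := by
  by_contra ha
  have ha0 : 0 < a := pos_of_mul_pos_left (hA _ hab) (heven.pow_nonneg b)
  obtain ⟨x, hx⟩ := (h a).2 ⟨ha0.le, ha⟩
  exact ((h (a * b ^ m)).1 ⟨b • x, by rw [eval_smul_of_isHomogeneous hQ, hx, mul_comm]⟩).2 hab

/-- For a prime p above S, the set {p} satisfies (2) because p is squarefree. The form missing only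
p represents all of S without being universal. -/
theorem not_isCriterionSet {m : ℕ} (hm : 2 < m) (heven : Even m) {S : Set ℤ} (hS : S.Finite) :
    ¬ IsCriterionSet m S := by
  intro hcrit
  -- A universal form shows that a criterion set has no negative elements.
  obtain ⟨n₀, Q₀, hQ₀, hrep₀, -⟩ := exists_form_of_closed hm heven ∅ (by simp) (by simp)
  have hnonneg : ∀ a ∈ S, 0 ≤ a := fun a ha =>
    ((hrep₀ a).1 ((hcrit n₀ Q₀ hQ₀).1 (fun b hb => (hrep₀ b).2 ⟨hb.le, by simp⟩) a ha)).1
  obtain ⟨M, hM⟩ := hS.bddAbove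
  obtain ⟨p, hpM, hp⟩ := Nat.exists_infinite_primes (M.toNat + 1)
  have hpos : ∀ a ∈ ({(p : ℤ)} : Finset ℤ), 0 < a := by simp [hp.pos]
  have hclosed : ∀ a b : ℤ, a * b ^ m ∈ ({(p : ℤ)} : Finset ℤ) → a ∈ ({(p : ℤ)} : Finset ℤ) := by
    intro a b hab
    rw [Finset.mem_singleton] at hab ⊢
    have hdvd : b ^ m ∣ (p : ℤ) := hab ▸ dvd_mul_left _ _
    have hb : IsUnit b := (Nat.prime_iff_prime_int.1 hp).irreducible.squarefree b
      (by rw [← sq]; exact (pow_dvd_pow b hm.le).trans hdvd)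
    have hb1 : b ^ m = 1 := by
      rcases Int.isUnit_iff.1 hb with rfl | rfl
      · exact one_pow m
      · exact heven.neg_one_pow
    rwa [hb1, mul_one] at hab
  obtain ⟨n, Q, hQ, hrep, -⟩ := exists_form_of_closed hm heven {(p : ℤ)} hpos hclosed
  have huniv : IsUniversal Q := (hcrit n Q hQ).2 fun a ha => (hrep a).2 ⟨hnonneg a ha, by
    have := hM ha
    rw [Finset.mem_singleton]
    omega⟩
  exact ((hrep p).1 (huniv p (hpos p (Finset.mem_singleton_self _)))).2
    (Finset.mem_singleton_self _)

theorem theorem1p1 (m : ℕ) (hm : 2 < m) (heven : Even m) :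
    (∀ A : Finset ℤ, (∀ a ∈ A, 0 < a) →
      ((∃ (n : ℕ) (Q : MvPolynomial (Fin n) ℤ),
          IsPosDefForm m Q ∧ RepresentsExactlyCompl Q A) ↔
        (∀ a b : ℤ, a * b ^ m ∈ A → a ∈ A)) ∧
      ((∀ a b : ℤ, a * b ^ m ∈ A → a ∈ A) →
        ∃ (n : ℕ) (Q : MvPolynomial (Fin n) ℤ),
          IsPosDefForm m Q ∧ RepresentsExactlyCompl Q A ∧
          n < (largestElement A + 1) * (waringG m + 1))) ∧
    (∀ S : Set ℤ, S.Finite → ¬ IsCriterionSet m S) := by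
  refine ⟨fun A hA => ⟨⟨?_, fun h => ?_⟩, exists_form_of_closed hm heven A hA⟩,
    fun S hS => not_isCriterionSet hm heven hS⟩
  · rintro ⟨n, Q, hQ, hrep⟩
    exact closed_of_representsExactlyCompl heven hA hQ.homogeneous hrep
  · obtain ⟨n, Q, hQ, hrep, -⟩ := exists_form_of_closed hm heven A hA h
    exact ⟨n, Q, hQ, hrep⟩
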